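/- Let $Q=p^r$, where $p$ is an odd prime and $r\ge 1$, and let $N_Q$ be the number of $\gamma\in\mathbb{F}_Q$ such that $\gamma-1,\gamma,\gamma+1$ are all non-squares in $\mathbb{F}_Q$ (here $0$ counts as a square). If $Q\le 9$, then $N_Q=0$. If $Q>9$, then $$N_Q\ \ge\ \frac18\bigl(Q-2\sqrt Q-3\bigr),$$ with equality if and only if $p\equiv 3\pmod 4$ and $r=2s$ with $s$ odd. Hence $N_Q>0$ if and only if $Q>9$. Moreover, $N_Q$ is given exactly as follows. 1. If $Q\equiv 7\pmod 8$, then $N_Q=\frac{Q-7}{8}$. 2. If $Q\equiv 3\pmod 8$, then $N_Q=\frac{Q-3}{8}$. 3. If $Q\equiv 5\pmod 8$, then $N_Q=\frac{Q-2s-3}{8}$. 4. If $Q\equiv 1\pmod 8$ and $p\equiv 1\pmod 4$, then $N_Q=\frac{Q+2s-3}{8}$. 5. If $Q\equiv 1\pmod 8$ and $p\equiv 3\pmod 4$, then $r$ is even and $N_Q=\frac18\bigl(Q+2(-1)^{r/2}\sqrt Q-3\bigr)$. In cases 3 and 4, $s$ is the unique integer such that $s\equiv 1\pmod 4$, $p\nmid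 s$ and $Q=s^2+t^2$ for some integer $t$. -/

import Mathlib

/-- `N_F`: the number of `γ` in a field `F` such that `γ - 1`, `γ`, `γ + 1` are all
non-squares in `F` (the element `0 = 0 ^ 2` is a square). -/
noncomputable def nonsquareTripleCount (F : Type*) [Field F] : ℕ :=
  Set.ncard {γ : F | ¬ IsSquare (γ - 1) ∧ ¬ IsSquare γ ∧ ¬ IsSquare (γ + 1)}

/-- `s` is the odd coordinate, prime to `p` and normalized to be `1` modulo `4`, in a
representation `Q = s ^ 2 + t ^ 2` as a sum of two integer squares. -/
def IsNormalizedCoordinate (p Q : ℕ) (s : ℤ) : Prop :=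
  s ≡ 1 [ZMOD 4] ∧ ¬ (p : ℤ) ∣ s ∧ ∃ t : ℤ, (Q : ℤ) = s ^ 2 + t ^ 2

/-! Let χ be the quadratic character and Q the order of `F`. The product (1 - χ(γ-1))(1 - χ(γ))(1 -
χ(γ+1)) is 8 on the triples counted and 0 elsewhere, except possibly at γ = -1. Since χ sums to 0
and has autocorrelation -1, expanding gives 8N = Q - 3 - S - (correction at γ = -1), where S = ∑
χ(x³ - x).

If Q ≡ 3 mod 4, the substitution x ↦ -x gives S = 0. If Q ≡ 1 mod 4, the correction vanishes and S =
J + J̄ = 2a, where J = J(ψ, ψ²) = a + bi is a Jacobi sum of a quartic character ψ with values in the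
Gaussian integers. Its norm gives Q = a² + b², and J ≡ -Q mod 2(i - 1) fixes the sign of a. For p ≡
1 mod 4, reducing S mod p and using Lucas' theorem gives p ∤ a, so ±a is the normalized coordinate
and |a| < √Q. For p ≡ 3 mod 4, descent forces b = 0 and a = ±√Q; the lower bound is attained exactly
when a = √Q. -/

/-! ### Arithmetic of sums of two squares and of a binomial coefficient. -/

/-- For `p` an odd prime, two representations `s ^ 2 + t ^ 2` of a power of `p` with odd first
coordinates prime to `p` agree up to sign. -/
theorem sq_eq_sq_of_sum_two_squares_eq_prime_pow {p r : ℕ} (hp : p.Prime) (hp2 : Odd p)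
    (hr : r ≠ 0) {s t u v : ℤ} (hst : (p : ℤ) ^ r = s ^ 2 + t ^ 2)
    (huv : (p : ℤ) ^ r = u ^ 2 + v ^ 2) (hs : Odd s) (hu : Odd u)
    (hps : ¬ (p : ℤ) ∣ s) (hpu : ¬ (p : ℤ) ∣ u) : s ^ 2 = u ^ 2 := by
  have hpI : Prime (p : ℤ) := Nat.prime_iff_prime_int.mp hp
  have hQodd : Odd ((p : ℤ) ^ r) := (by exact_mod_cast hp2 : Odd (p : ℤ)).pow
  have even_snd : ∀ {x y : ℤ}, Odd x → (p : ℤ) ^ r = x ^ 2 + y ^ 2 → Even y := by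
    intro x y hx h
    rw [h] at hQodd
    have : Odd (x ^ 2) := hx.pow
    have h2 : Even (y ^ 2) := by
      by_contra hc
      exact (Int.not_even_iff_odd.mpr hQodd) (this.add_odd (Int.not_even_iff_odd.mp hc))
    exact (Int.even_pow.mp h2).1
  have ht := even_snd hs hst
  have hv := even_snd hu huv
  have hpQ : (p : ℤ) ∣ (p : ℤ) ^ r := dvd_pow_self _ hr
  have hpv : ¬ (p : ℤ) ∣ v := fun h ↦ hpu <| hpI.dvd_of_dvd_pow (n := 2) <| by
    have : (p : ℤ) ∣ u ^ 2 + v ^ 2 := huv ▸ hpQ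
    exact (dvd_add_left (dvd_pow h two_ne_zero)).mp this
  have hp2' : ¬ (p : ℤ) ∣ 2 := by
    intro h
    have : p ∣ 2 := by exact_mod_cast h
    have := (Nat.prime_dvd_prime_iff_eq hp Nat.prime_two).mp this
    subst this
    exact absurd hp2 (by decide)
  have hQpos : (0 : ℤ) < (p : ℤ) ^ r := pow_pos (by exact_mod_cast hp.pos) r
  -- the case where the whole power divides one of the two factors
  have key : ∀ w : ℤ, Even w → (p : ℤ) ^ r = u ^ 2 + w ^ 2 → (p : ℤ) ^ r ∣ s * w - u * t →
      s ^ 2 = u ^ 2 := by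
    rintro w hw huw ⟨k, hk⟩
    -- Brahmagupta's identity. The second coordinate is odd, hence nonzero, so the first is smaller
    -- than Q in absolute value; being divisible by Q, it is 0.
    have hid : (s * w - u * t) ^ 2 + (s * u + t * w) ^ 2 = ((p : ℤ) ^ r) ^ 2 := by
      calc _ = (s ^ 2 + t ^ 2) * (u ^ 2 + w ^ 2) := by ring
        _ = _ := by rw [← hst, ← huw, sq]
    have hne : s * u + t * w ≠ 0 := by
      intro h
      have h1 : Odd (s * u + t * w) := (hs.mul hu).add_even (ht.mul_right w)
      rw [h] at h1
      exact absurd h1 (by decide)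
    have hlt : (s * w - u * t) ^ 2 < ((p : ℤ) ^ r) ^ 2 := by
      have := pow_pos (abs_pos.mpr hne) 2
      rw [sq_abs] at this
      linarith
    rw [hk, mul_pow] at hlt
    have hk1 : k ^ 2 < 1 := by
      by_contra hc
      have := mul_le_mul_of_nonneg_left (not_lt.mp hc) (sq_nonneg ((p : ℤ) ^ r))
      linarith
    have hk0 : k = 0 := by
      have : k ^ 2 = 0 := le_antisymm (by linarith) (sq_nonneg k)
      exact pow_eq_zero_iff two_ne_zero |>.mp this
    rw [hk0, mul_zero] at hk
    have h3 : s ^ 2 * (p : ℤ) ^ r = u ^ 2 * (p : ℤ) ^ r := by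
      nth_rewrite 1 [huw]
      rw [hst]
      linear_combination (s * w + u * t) * hk
    exact mul_right_cancel₀ hQpos.ne' h3
  have hprod : (p : ℤ) ^ r ∣ (s * v - u * t) * (s * v + u * t) := by
    refine ⟨s ^ 2 - u ^ 2, ?_⟩
    linear_combination (u ^ 2) * hst - (s ^ 2) * huv
  -- `p` cannot divide both factors, since it would divide their sum 2sv; so all of `p ^ r` divides
  -- one of them. Replacing v by -v exchanges the two cases.
  by_cases h1 : (p : ℤ) ∣ s * v - u * t
  · have h2 : ¬ (p : ℤ) ∣ s * v + u * t := by
      intro h2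
      have h3 : (p : ℤ) ∣ 2 * (s * v) := by
        have := dvd_add h1 h2
        rwa [show s * v - u * t + (s * v + u * t) = 2 * (s * v) by ring] at this
      rcases hpI.dvd_or_dvd h3 with h | h
      · exact hp2' h
      · rcases hpI.dvd_or_dvd h with h | h
        · exact hps h
        · exact hpv h
    exact key v hv huv (hpI.pow_dvd_of_dvd_mul_right r h2 hprod)
  · refine key (-v) hv.neg (by rw [neg_sq, huv]) ?_
    have h := hpI.pow_dvd_of_dvd_mul_left r h1 hprod
    rw [show s * -v - u * t = -(s * v + u * t) by ring]
    exact h.neg_right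

/-- For a prime `p` congruent to `3` modulo `4`, the only representations of `p ^ (2 * m)` as a
sum of two squares are the trivial ones. -/
theorem sum_two_squares_eq_prime_pow_of_mod_four_eq_three {p : ℕ} (hp : p.Prime) (hp3 : p % 4 = 3)
    (m : ℕ) {a b : ℤ} (ha : Odd a) (h : a ^ 2 + b ^ 2 = (p : ℤ) ^ (2 * m)) :
    b = 0 ∧ (a = (p : ℤ) ^ m ∨ a = -(p : ℤ) ^ m) := by
  have : Fact p.Prime := ⟨hp⟩
  induction m generalizing a b with
  | zero =>
    simp only [mul_zero, pow_zero] at h ⊢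
    have ha0 : a ≠ 0 := by rintro rfl; exact absurd ha (by decide)
    have h1 := pow_pos (abs_pos.mpr ha0) 2
    rw [sq_abs] at h1
    have hb : b ^ 2 = 0 := le_antisymm (by linarith) (sq_nonneg b)
    refine ⟨pow_eq_zero_iff two_ne_zero |>.mp hb, ?_⟩
    rw [hb, add_zero] at h
    exact sq_eq_sq_iff_eq_or_eq_neg.mp (by rw [h, one_pow])
  | succ m ih =>
    -- Descent: -1 is not a square mod `p`, so both coordinates are divisible by `p`, and `p ^ 2`
    -- can be cancelled.
    have hb : (p : ℤ) ∣ a ∧ (p : ℤ) ∣ b := by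
      have hz : (a : ZMod p) ^ 2 + (b : ZMod p) ^ 2 = 0 := by
        have := congrArg (Int.cast : ℤ → ZMod p) h
        simpa using this
      have main : ∀ {x y : ℤ}, (x : ZMod p) ^ 2 + (y : ZMod p) ^ 2 = 0 → (p : ℤ) ∣ x := by
        intro x y hxy
        rw [← ZMod.intCast_zmod_eq_zero_iff_dvd]
        by_contra hx
        have : IsSquare (-1 : ZMod p) := by
          refine ⟨(y : ZMod p) / x, ?_⟩
          field_simp
          linear_combination -hxy
        exact ZMod.exists_sq_eq_neg_one_iff.mp this hp3
      exact ⟨main hz, main (by rw [add_comm]; exact hz)⟩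
    obtain ⟨⟨a', rfl⟩, ⟨b', rfl⟩⟩ := hb
    have hp0 : (p : ℤ) ≠ 0 := by exact_mod_cast hp.ne_zero
    have h' : a' ^ 2 + b' ^ 2 = (p : ℤ) ^ (2 * m) := by
      have h0 : (p : ℤ) ^ 2 ≠ 0 := pow_ne_zero _ hp0
      refine mul_left_cancel₀ h0 ?_
      linear_combination h
    obtain ⟨h1, h2⟩ := ih (Int.odd_mul.mp ha).2 h'
    refine ⟨by rw [h1, mul_zero], ?_⟩
    rcases h2 with h2 | h2
    · left; rw [h2, pow_succ']
    · right; rw [h2, pow_succ']; ring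

/-- If `p = 4 * c + 1` is prime and `p ^ r = 4 * m + 1`, then `p` does not divide the central
binomial coefficient `(2 * m).choose m`. -/
theorem not_dvd_choose_of_prime_pow_eq {p : ℕ} (hp : p.Prime) (hp1 : p % 4 = 1) (r : ℕ) :
    ∀ m : ℕ, p ^ r = 4 * m + 1 → ¬ p ∣ (2 * m).choose m := by
  have : Fact p.Prime := ⟨hp⟩
  induction r with
  | zero =>
    intro m hm
    obtain rfl : m = 0 := by simpa using hm
    simpa using hp.one_lt.ne'
  | succ r ih =>
    intro m hm
    obtain ⟨c, hc⟩ : ∃ c, p = 4 * c + 1 := ⟨p / 4, by omega⟩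
    obtain ⟨k, hk⟩ : ∃ k, p ^ r = 4 * k + 1 := by
      refine ⟨p ^ r / 4, ?_⟩
      have : p ^ r % 4 = 1 := by simp [Nat.pow_mod, hp1]
      omega
    have hmk : m = c + p * k := by
      rw [pow_succ, hk] at hm
      nlinarith
    -- Lucas' theorem on the last base-`p` digit: doubling m = c + pk produces no carry, because 2c
    -- < p.
    have h := Choose.choose_modEq_choose_mod_mul_choose_div_nat (n := 2 * m) (k := m) (p := p)
    have e1 : 2 * m = 2 * c + p * (2 * k) := by rw [hmk]; ring
    have hcp : c < p := by omega
    have hcp2 : 2 * c < p := by omega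
    have d1 : 2 * m % p = 2 * c := by
      rw [e1, Nat.add_mul_mod_self_left, Nat.mod_eq_of_lt hcp2]
    have d2 : m % p = c := by rw [hmk, Nat.add_mul_mod_self_left, Nat.mod_eq_of_lt hcp]
    have d3 : 2 * m / p = 2 * k := by
      rw [e1, Nat.add_mul_div_left _ _ hp.pos, Nat.div_eq_of_lt hcp2, zero_add]
    have d4 : m / p = k := by
      rw [hmk, Nat.add_mul_div_left _ _ hp.pos, Nat.div_eq_of_lt hcp, zero_add]
    rw [d1, d2, d3, d4] at h
    rw [(Nat.ModEq.dvd_iff h dvd_rfl), hp.dvd_mul, not_or]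
    exact ⟨(hp.coprime_iff_not_dvd).mp (Nat.Prime.coprime_choose_of_lt hp hcp2 (by omega)), ih k hk⟩

/-! ### Quartic characters and Jacobi sums in the Gaussian integers. -/

/-- The quadratic character of a finite field of odd order takes the values of the square of a
quartic character. -/
theorem MulChar.sq_eq_quadraticChar_of_orderOf_eq_four {F R : Type*} [Field F] [Fintype F]
    [DecidableEq F] [CommRing R] [IsDomain R] {ψ : MulChar F R} (hψ : orderOf ψ = 4) :
    ψ ^ 2 = (quadraticChar F).ringHomComp (Int.castRingHom R) := by
  have h4 : ψ ^ 4 = 1 := hψ ▸ pow_orderOf_eq_one ψ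
  have h4' : ∀ x : F, x ≠ 0 → ψ x ^ 4 = 1 := fun x hx ↦ by
    rw [← MulChar.pow_apply' ψ four_ne_zero, h4, MulChar.one_apply hx.isUnit]
  have hsq : ∀ x : F, x ≠ 0 → IsSquare x → ψ x ^ 2 = 1 := by
    rintro x hx ⟨y, rfl⟩
    have hy : y ≠ 0 := left_ne_zero_of_mul hx
    rw [map_mul, ← h4' y hy]; ring
  have hne : ψ ^ 2 ≠ 1 := fun h ↦ by
    have := orderOf_dvd_of_pow_eq_one h
    rw [hψ] at this
    omega
  obtain ⟨z, hz⟩ := MulChar.ne_one_iff.mp hne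
  rw [MulChar.pow_apply' ψ two_ne_zero] at hz
  have hz2 : ψ (z : F) ^ 2 = -1 := by
    have h : (ψ (z : F) ^ 2) ^ 2 = 1 ^ 2 := by rw [← pow_mul, h4' _ z.ne_zero, one_pow]
    exact (sq_eq_sq_iff_eq_or_eq_neg.mp h).resolve_left hz
  have hzs : quadraticChar F z = -1 :=
    quadraticChar_neg_one_iff_not_isSquare.mpr fun h ↦ hz (hsq _ z.ne_zero h)
  ext x
  have hx : (x : F) ≠ 0 := x.ne_zero
  rw [MulChar.pow_apply' ψ two_ne_zero, MulChar.ringHomComp_apply]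
  rcases quadraticChar_dichotomy hx with h | h
  · rw [h, hsq _ hx ((quadraticChar_one_iff_isSquare hx).mp h)]
    simp
  -- Multiplying by the nonsquare z, where ψ² is -1, reduces nonsquares to squares.
  · have hxz : IsSquare ((x : F) * z) := by
      rw [← quadraticChar_one_iff_isSquare (mul_ne_zero hx z.ne_zero), map_mul, h, hzs]
      norm_num
    have h1 := hsq _ (mul_ne_zero hx z.ne_zero) hxz
    rw [map_mul, mul_pow, hz2] at h1
    rw [h]
    simp only [Int.reduceNeg, eq_intCast, Int.cast_neg, Int.cast_one]
    linear_combination -h1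

theorem GaussianInt.isPrimitiveRoot_i : IsPrimitiveRoot (⟨0, 1⟩ : GaussianInt) 4 := by
  have h2 : (⟨0, 1⟩ : GaussianInt) ^ 2 = -1 := by
    rw [sq]; ext <;> simp
  rw [show 4 = 2 ^ (1 + 1) by norm_num]
  refine IsPrimitiveRoot.iff_orderOf.mpr (orderOf_eq_prime_pow ?_ ?_)
  · rw [pow_one, h2]; decide
  · rw [show 2 ^ (1 + 1) = 2 * 2 by norm_num, pow_mul, h2]; norm_num

section
variable {F : Type*} [Field F] [Fintype F] [DecidableEq F]

/-- A quartic character transforms the cubic character sum into a sum of two Jacobi sums. -/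
theorem sum_quadraticChar_cube_sub_eq_jacobiSum_add {R : Type*} [CommRing R] [IsDomain R]
    (hF : Fintype.card F % 4 = 1) {ψ : MulChar F R} (hψ : orderOf ψ = 4) :
    ((∑ x : F, quadraticChar F (x * (x ^ 2 - 1)) : ℤ) : R) =
      jacobiSum ψ (ψ ^ 2) + jacobiSum ψ⁻¹ (ψ ^ 2) := by
  have hchar : ringChar F ≠ 2 := fun h ↦ by
    have := FiniteField.even_card_of_char_two h
    omega
  have hinv : ψ⁻¹ = ψ * ψ ^ 2 := by
    have h4 : ψ ^ 4 = 1 := hψ ▸ pow_orderOf_eq_one ψ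
    rw [← pow_succ', inv_eq_iff_mul_eq_one, ← pow_succ', ← h4]
  have hq := MulChar.sq_eq_quadraticChar_of_orderOf_eq_four hψ
  have hneg : quadraticChar F (-1) = 1 := by
    rw [quadraticChar_one_iff_isSquare (neg_ne_zero.mpr one_ne_zero),
      FiniteField.isSquare_neg_one_iff]
    omega
  have hval : ∀ x : F, ((quadraticChar F x : ℤ) : R) = ψ x ^ 2 := fun x ↦ by
    rw [← MulChar.pow_apply' ψ two_ne_zero, hq, MulChar.ringHomComp_apply, eq_intCast]
  have hflip : ∀ x : F, ψ (x - 1) ^ 2 = ψ (1 - x) ^ 2 := fun x ↦ by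
    rw [← hval, ← hval, ← neg_sub, neg_eq_neg_one_mul, map_mul, hneg, one_mul]
  calc ((∑ x : F, quadraticChar F (x * (x ^ 2 - 1)) : ℤ) : R)
      = ∑ x : F, ψ (x ^ 2) * ψ (1 - x ^ 2) ^ 2 := by
        rw [Int.cast_sum]
        refine Finset.sum_congr rfl fun x _ ↦ ?_
        rw [hval, map_mul, map_pow, mul_pow, hflip]
    _ = ∑ y : F, ∑ x : F with x ^ 2 = y, ψ (x ^ 2) * ψ (1 - x ^ 2) ^ 2 :=
        (Finset.sum_fiberwise _ _ _).symm
    -- The fibre of squaring over y has 1 + χ(y) elements, and χ = ψ².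
    _ = ∑ y : F, (1 + ψ y ^ 2) * (ψ y * ψ (1 - y) ^ 2) := by
        refine Finset.sum_congr rfl fun y _ ↦ ?_
        rw [Finset.sum_congr rfl (g := fun _ ↦ ψ y * ψ (1 - y) ^ 2), Finset.sum_const,
          nsmul_eq_mul]
        · congr 1
          have h := congrArg (Int.cast : ℤ → R) (quadraticChar_card_sqrts hchar y)
          rw [Int.cast_add, Int.cast_one, hval, add_comm, Int.cast_natCast] at h
          rw [← h]
          congr 2
          ext x
          simp
        · intro x hx
          rw [(Finset.mem_filter.mp hx).2]
    _ = _ := by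
        rw [jacobiSum, jacobiSum, ← Finset.sum_add_distrib]
        refine Finset.sum_congr rfl fun y _ ↦ ?_
        rw [hinv, MulChar.mul_apply, MulChar.pow_apply' ψ two_ne_zero,
          MulChar.pow_apply' ψ two_ne_zero]
        ring

open GaussianInt in
/-- The cubic character sum attached to `x ^ 3 - x` is twice the normalized coordinate in a
representation of the order of the field as a sum of two squares. -/
theorem exists_sum_quadraticChar_cube_sub_eq_two_mul (hF : Fintype.card F % 4 = 1) :
    ∃ a b : ℤ, ∑ x : F, quadraticChar F (x * (x ^ 2 - 1)) = 2 * a ∧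
      (Fintype.card F : ℤ) = a ^ 2 + b ^ 2 ∧ 2 ∣ b ∧ 4 ∣ a + 1 - b := by
  have hchar : ringChar F ≠ 2 := fun h ↦ by
    have := FiniteField.even_card_of_char_two h
    omega
  obtain ⟨ψ, hψ⟩ := MulChar.exists_mulChar_orderOf F (n := 4) (by omega) isPrimitiveRoot_i
  have h4 : ψ ^ 4 = 1 := hψ ▸ pow_orderOf_eq_one ψ
  have hq := MulChar.sq_eq_quadraticChar_of_orderOf_eq_four hψ
  have hψ1 : ψ ≠ 1 := fun h ↦ by rw [h, orderOf_one] at hψ; omega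
  have hψ2 : ψ ^ 2 ≠ 1 := fun h ↦ by
    have := orderOf_dvd_of_pow_eq_one h
    rw [hψ] at this
    omega
  have hψ3 : ψ * ψ ^ 2 ≠ 1 := fun h ↦ by
    rw [← pow_succ'] at h
    have := orderOf_dvd_of_pow_eq_one h
    rw [hψ] at this
    omega
  set J := jacobiSum ψ (ψ ^ 2) with hJ
  have hinv2 : (ψ ^ 2)⁻¹ = ψ ^ 2 := by
    rw [inv_eq_iff_mul_eq_one, ← pow_add]; exact h4
  -- complex conjugation inverts the character
  have hstarinv : ∀ x : F, star (ψ x) = ψ⁻¹ x := by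
    intro x
    by_cases hx : x = 0
    · rw [hx, MulChar.map_zero, MulChar.map_zero, star_zero]
    have h1 : ψ x * ψ⁻¹ x = 1 := by
      rw [← MulChar.mul_apply, mul_inv_cancel, MulChar.one_apply (Ne.isUnit hx)]
    have h2 : ψ x * star (ψ x) = 1 := by
      have hu : IsUnit (ψ x) := IsUnit.of_mul_eq_one _ h1
      rw [← Zsqrtd.norm_eq_mul_conj, (Zsqrtd.norm_eq_one_iff' (by norm_num) _).mpr hu]
      rfl
    exact mul_left_cancel₀ (left_ne_zero_of_mul_eq_one h1) (h2.trans h1.symm)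
  have hstar : star J = jacobiSum ψ⁻¹ (ψ ^ 2) := by
    have h2 : ∀ x : F, star ((ψ ^ 2) x) = (ψ ^ 2) x := fun x ↦ by
      rw [hq, MulChar.ringHomComp_apply, eq_intCast, star_intCast]
    rw [hJ, jacobiSum, jacobiSum, star_sum]
    refine Finset.sum_congr rfl fun x _ ↦ ?_
    rw [star_mul', h2, hstarinv]
  have hS := sum_quadraticChar_cube_sub_eq_jacobiSum_add hF hψ
  rw [← hJ, ← hstar] at hS
  -- the norm of the Jacobi sum
  have hnorm : J * star J = (Fintype.card F : GaussianInt) := by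
    -- The norm formula for Jacobi sums needs values in a field, so it is applied in ℂ and pulled
    -- back.
    have hinj : Function.Injective toComplex := toComplex_injective
    have hne : ∀ φ : MulChar F GaussianInt, φ ≠ 1 → φ.ringHomComp toComplex ≠ 1 := fun φ hφ ↦
      (MulChar.ringHomComp_ne_one_iff hinj).mpr hφ
    have hc : ringChar ℂ ≠ ringChar F := by
      rw [ringChar.eq_zero]
      exact (CharP.ringChar_ne_zero_of_finite F).symm
    have h := jacobiSum_mul_jacobiSum_inv hc (hne _ hψ1) (hne _ hψ2)
      (by rw [← MulChar.ringHomComp_mul]; exact hne _ hψ3)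
    have hcomp_inv : ∀ φ : MulChar F GaussianInt,
        (φ.ringHomComp toComplex)⁻¹ = φ⁻¹.ringHomComp toComplex := fun φ ↦ by
      rw [inv_eq_iff_mul_eq_one, ← MulChar.ringHomComp_mul, mul_inv_cancel,
        MulChar.ringHomComp_one]
    rw [hcomp_inv, hcomp_inv, hinv2, jacobiSum_ringHomComp, jacobiSum_ringHomComp, ← hstar,
      ← hJ, ← map_mul] at h
    apply hinj
    rw [h, map_natCast]
  -- the congruence satisfied by the Jacobi sum
  obtain ⟨w, hw⟩ : ∃ w : GaussianInt, J + (Fintype.card F : GaussianInt) =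
      w * (2 * (⟨0, 1⟩ - 1)) := by
    have hterm : ∀ x : F, (ψ x - 1) * ((ψ ^ 2) (1 - x) - 1) =
        ψ x * (ψ ^ 2) (1 - x) - ψ x - (ψ ^ 2) (1 - x) + 1 := fun x ↦ by ring
    have hsum : ∑ x : F, (ψ x - 1) * ((ψ ^ 2) (1 - x) - 1) =
        J + (Fintype.card F : GaussianInt) := by
      have hshift : ∑ x : F, (ψ ^ 2) (1 - x) = 0 :=
        ((Equiv.subLeft (1 : F)).sum_comp (fun x ↦ (ψ ^ 2) x)).trans
          (MulChar.sum_eq_zero_of_ne_one hψ2)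
      simp_rw [hterm]
      rw [Finset.sum_add_distrib, Finset.sum_sub_distrib, Finset.sum_sub_distrib,
        MulChar.sum_eq_zero_of_ne_one hψ1, hshift, hJ, jacobiSum]
      simp
    have hdvd : (2 * (⟨0, 1⟩ - 1) : GaussianInt) ∣
        ∑ x : F, (ψ x - 1) * ((ψ ^ 2) (1 - x) - 1) := by
      -- At x = 0 and x = 1 one factor is a character value at 1, minus 1, so the term vanishes.
      -- Otherwise i - 1 divides the first factor and 2 the second.
      refine Finset.dvd_sum fun x _ ↦ ?_
      by_cases hx0 : x = 0
      · simp [hx0]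
      by_cases hx1 : x = 1
      · simp [hx1]
      obtain ⟨k, -, hk⟩ := MulChar.exists_apply_eq_pow h4 isPrimitiveRoot_i hx0
      rw [hk, mul_comm (2 : GaussianInt)]
      refine mul_dvd_mul (by simpa using sub_dvd_pow_sub_pow (⟨0, 1⟩ : GaussianInt) 1 k) ?_
      rw [hq, MulChar.ringHomComp_apply]
      rcases quadraticChar_dichotomy (sub_ne_zero.mpr (Ne.symm hx1)) with h | h
      · rw [h]; simp
      · rw [h]; exact ⟨-1, by norm_num⟩
    rw [hsum] at hdvd
    obtain ⟨w, hw⟩ := hdvd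
    exact ⟨w, by rw [hw, mul_comm]⟩
  refine ⟨J.re, J.im, ?_, ?_, ?_, ?_⟩
  · have h := congrArg Zsqrtd.re hS
    rw [Zsqrtd.re_intCast, Zsqrtd.re_add, Zsqrtd.re_star] at h
    rw [h]; ring
  · have h := congrArg Zsqrtd.re hnorm
    rw [Zsqrtd.re_natCast, Zsqrtd.re_mul, Zsqrtd.re_star, Zsqrtd.im_star] at h
    rw [← h]; ring
  · have h := congrArg Zsqrtd.im hw
    simp at h
    omega
  -- With w = x + yi: a + Q = -2x - 2y and b = 2x - 2y, so a + Q - b = -4x, and Q ≡ 1 mod 4.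
  · have h1 := congrArg Zsqrtd.im hw
    have h2 := congrArg Zsqrtd.re hw
    simp at h1 h2
    omega
end

/-! ### Reduction of the cubic sum mod p, and the counting formula. -/

section
variable {F : Type*} [Field F] [Fintype F] [DecidableEq F]

/-- The character sum attached to `x ^ 3 - x`, as an element of the field. -/
theorem cast_sum_quadraticChar_cube_sub {m : ℕ} (hm : Fintype.card F = 4 * m + 1) :
    ((∑ x : F, quadraticChar F (x * (x ^ 2 - 1)) : ℤ) : F) = -((-1) ^ m * ((2 * m).choose m : F)) := by
  have hchar : ringChar F ≠ 2 := fun h ↦ by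
    have := FiniteField.even_card_of_char_two h
    omega
  have hcard := Fintype.one_lt_card (α := F)
  have hm0 : 0 < m := by omega
  have hpow : ∀ x : F, x ≠ 0 → x ^ (4 * m) = 1 := fun x hx ↦ by
    have := FiniteField.pow_card_sub_one_eq_one x hx
    rwa [hm, Nat.add_sub_cancel] at this
  have hlow : ∀ i, i < 4 * m → ∑ x : F, x ^ i = 0 := fun i hi ↦
    FiniteField.sum_pow_lt_card_sub_one F i (by omega)
  have hmid : ∑ x : F, x ^ (4 * m) = -1 := by
    have h0 : ∀ x : F, x ^ (4 * m) = 1 - if x = 0 then 1 else 0 := fun x ↦ by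
      split_ifs with h
      · rw [h, zero_pow (by omega), sub_self]
      · rw [hpow x h, sub_zero]
    simp_rw [h0]
    simp
  have hhigh : ∀ i, 0 < i → i < 4 * m → ∑ x : F, x ^ (4 * m + i) = 0 := fun i hi hi' ↦ by
    rw [← hlow i hi']
    refine Finset.sum_congr rfl fun x _ ↦ ?_
    by_cases hx : x = 0
    · rw [hx, zero_pow (by omega), zero_pow hi.ne']
    · rw [pow_add, hpow x hx, one_mul]
  -- Euler's criterion and the binomial theorem. The exponents run from 2m to 6m, and power sums
  -- vanish there except at 4m = Q - 1, that is k = m.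
  have hterm : ∀ x : F, ((quadraticChar F (x * (x ^ 2 - 1)) : ℤ) : F) =
      ∑ k ∈ Finset.range (2 * m + 1),
        (-1) ^ (2 * m - k) * ((2 * m).choose k : F) * x ^ (2 * m + 2 * k) := fun x ↦ by
    rw [quadraticChar_eq_pow_of_char_ne_two' hchar, show Fintype.card F / 2 = 2 * m by omega,
      mul_pow, sub_eq_add_neg, add_pow, Finset.mul_sum]
    refine Finset.sum_congr rfl fun k _ ↦ ?_
    rw [pow_add, pow_mul x 2 k]; ring
  rw [Int.cast_sum]
  simp_rw [hterm]
  rw [Finset.sum_comm]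
  simp_rw [← Finset.mul_sum]
  rw [Finset.sum_eq_single m]
  · rw [show 2 * m + 2 * m = 4 * m by ring, hmid, show 2 * m - m = m by omega]
    ring
  · intro k hk hkm
    have hk' := Finset.mem_range.mp hk
    rcases lt_or_gt_of_ne hkm with h | h
    · rw [hlow _ (by omega), mul_zero]
    · rw [show 2 * m + 2 * k = 4 * m + 2 * (k - m) by omega, hhigh _ (by omega) (by omega),
        mul_zero]
  · intro h
    exact absurd (Finset.mem_range.mpr (by omega)) h

/-- In `F` the sum is a central binomial coefficient up to sign, nonzero by Lucas. This makes the
real part of the Jacobi sum prime to `p`. -/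
theorem not_dvd_sum_quadraticChar_cube_sub {p r : ℕ} (hp : p.Prime) (hp1 : p % 4 = 1)
    (hF : Fintype.card F = p ^ r) :
    ¬ (p : ℤ) ∣ ∑ x : F, quadraticChar F (x * (x ^ 2 - 1)) := by
  have hmod : p ^ r % 4 = 1 := by simp [Nat.pow_mod, hp1]
  obtain ⟨m, hm⟩ : ∃ m, p ^ r = 4 * m + 1 := ⟨p ^ r / 4, by omega⟩
  have : Fact p.Prime := ⟨hp⟩
  have : CharP F p := charP_of_card_eq_prime_pow (f := r) hF
  rw [← CharP.intCast_eq_zero_iff F p, cast_sum_quadraticChar_cube_sub (hF.trans hm), neg_eq_zero,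
    mul_eq_zero, not_or]
  refine ⟨pow_ne_zero _ (neg_ne_zero.mpr one_ne_zero), ?_⟩
  rw [CharP.cast_eq_zero_iff F p]
  exact not_dvd_choose_of_prime_pow_eq hp hp1 r m hm

/-- The autocorrelation of the quadratic character at shift one. -/
theorem sum_quadraticChar_sub_one_mul (hF : ringChar F ≠ 2) :
    ∑ x : F, quadraticChar F (x - 1) * quadraticChar F x = -1 := by
  have hinv : (quadraticChar F)⁻¹ = quadraticChar F := (quadraticChar_isQuadratic F).inv
  have h := jacobiSum_nontrivial_inv (quadraticChar_ne_one hF)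
  rw [hinv, jacobiSum] at h
  have hsq : quadraticChar F (-1) ^ 2 = 1 :=
    quadraticChar_sq_one (neg_ne_zero.mpr one_ne_zero)
  calc _ = ∑ x : F, quadraticChar F (-1) * (quadraticChar F x * quadraticChar F (1 - x)) := by
        refine Finset.sum_congr rfl fun x _ ↦ ?_
        rw [← neg_sub, neg_eq_neg_one_mul, map_mul]; ring
    _ = -1 := by rw [← Finset.mul_sum, h]; linear_combination -hsq

theorem eight_mul_nonsquareTripleCount (hF : ringChar F ≠ 2) :
    8 * (nonsquareTripleCount F : ℤ) = Fintype.card F - 3 -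
      ∑ x : F, quadraticChar F (x * (x ^ 2 - 1)) -
      (1 - quadraticChar F (-2)) * (1 - quadraticChar F (-1)) := by
  have h2 : (2 : F) ≠ 0 := Ring.two_ne_zero hF
  have hval : ∀ x : F, x ≠ 0 → 1 - quadraticChar F x = if IsSquare x then 0 else 2 := by
    intro x hx
    split_ifs with h
    · rw [(quadraticChar_one_iff_isSquare hx).mpr h]; rfl
    · rw [quadraticChar_neg_one_iff_not_isSquare.mpr h]; rfl
  -- At x = 0 and x = 1 a factor 1 - χ(1) kills the product; at x = -1 the factor 1 - χ(0) = 1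
  -- leaves a spurious term to subtract.
  have hpt : ∀ x : F,
      8 * (if ¬ IsSquare (x - 1) ∧ ¬ IsSquare x ∧ ¬ IsSquare (x + 1) then 1 else 0 : ℤ) =
      (1 - quadraticChar F (x - 1)) * (1 - quadraticChar F x) * (1 - quadraticChar F (x + 1)) -
        if x = -1 then (1 - quadraticChar F (-2)) * (1 - quadraticChar F (-1)) else 0 := by
    intro x
    by_cases hx0 : x = 0
    · simp [hx0]
    by_cases hx1 : x = 1
    · have h1m : (1 : F) ≠ -1 := fun h ↦ h2 (by linear_combination h)
      simp [hx1, h1m]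
    by_cases hxm : x = -1
    · have : (-1 - 1 : F) = -2 := by ring
      simp [hxm, this]
    rw [hval _ hx0, hval _ (sub_ne_zero.mpr hx1), hval (x + 1) (fun h ↦ hxm (eq_neg_of_add_eq_zero_left h)),
      if_neg hxm]
    split_ifs <;> simp_all
  have hcount : (nonsquareTripleCount F : ℤ) =
      ∑ x : F, (if ¬ IsSquare (x - 1) ∧ ¬ IsSquare x ∧ ¬ IsSquare (x + 1) then 1 else 0 : ℤ) := by
    rw [nonsquareTripleCount, Set.ncard_eq_toFinset_card', Finset.sum_boole]
    congr 2
    ext x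
    simp
  have h0 := quadraticChar_sum_zero hF
  have hm : ∑ x : F, quadraticChar F (x - 1) = 0 :=
    (Fintype.sum_equiv (Equiv.subRight (1 : F)) _ (quadraticChar F) fun _ ↦ rfl).trans h0
  have hp : ∑ x : F, quadraticChar F (x + 1) = 0 :=
    (Fintype.sum_equiv (Equiv.addRight (1 : F)) _ (quadraticChar F) fun _ ↦ rfl).trans h0
  have h01 := sum_quadraticChar_sub_one_mul hF
  have h12 : ∑ x : F, quadraticChar F x * quadraticChar F (x + 1) = -1 := by
    rw [← h01]
    exact Fintype.sum_equiv (Equiv.addRight (1 : F)) _ _ fun x ↦ by simp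
  have h02 : ∑ x : F, quadraticChar F (x - 1) * quadraticChar F (x + 1) = -1 := by
    rw [← h01]
    -- The substitution x ↦ 2x - 1 turns shift two into shift one, up to the factor χ(2)² = 1.
    refine (Fintype.sum_equiv ((Equiv.mulLeft₀ (2 : F) h2).trans (Equiv.subRight 1)) _ _
      fun x ↦ ?_).symm
    have h22 : quadraticChar F 2 ^ 2 = 1 := quadraticChar_sq_one h2
    simp only [Equiv.trans_apply, Equiv.mulLeft₀_apply, Equiv.subRight_apply, sub_add_cancel]
    rw [show 2 * x - 1 - 1 = 2 * (x - 1) by ring, map_mul, map_mul]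
    linear_combination -(quadraticChar F (x - 1) * quadraticChar F x) * h22
  rw [hcount, Finset.mul_sum, Finset.sum_congr rfl fun x _ ↦ hpt x, Finset.sum_sub_distrib,
    Finset.sum_ite_eq' Finset.univ (-1 : F)]
  have hexp : ∀ x : F,
      (1 - quadraticChar F (x - 1)) * (1 - quadraticChar F x) * (1 - quadraticChar F (x + 1)) =
      1 - quadraticChar F (x - 1) - quadraticChar F x - quadraticChar F (x + 1) +
      quadraticChar F (x - 1) * quadraticChar F x + quadraticChar F x * quadraticChar F (x + 1) +
      quadraticChar F (x - 1) * quadraticChar F (x + 1) -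
      quadraticChar F (x * (x ^ 2 - 1)) := fun x ↦ by
    rw [show x * (x ^ 2 - 1) = (x - 1) * x * (x + 1) by ring, map_mul, map_mul]; ring
  simp_rw [hexp]
  simp only [Finset.sum_sub_distrib, Finset.sum_add_distrib]
  rw [h0, hm, hp, h01, h12, h02]
  simp
  ring

/-- The cubic is odd and -1 is a nonsquare, so x ↦ -x negates the sum. -/
theorem sum_quadraticChar_cube_sub_eq_zero (hF : Fintype.card F % 4 = 3) :
    ∑ x : F, quadraticChar F (x * (x ^ 2 - 1)) = 0 := by
  have hneg : quadraticChar F (-1) = -1 := by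
    rw [quadraticChar_neg_one_iff_not_isSquare, FiniteField.isSquare_neg_one_iff]
    omega
  have h : ∑ x : F, quadraticChar F (x * (x ^ 2 - 1)) =
      -∑ x : F, quadraticChar F (x * (x ^ 2 - 1)) := by
    rw [← Finset.sum_neg_distrib]
    refine Fintype.sum_equiv (Equiv.neg F) _ _ fun x ↦ ?_
    rw [Equiv.neg_apply, show -x * ((-x) ^ 2 - 1) = -1 * (x * (x ^ 2 - 1)) by ring,
      map_mul _ (-1 : F), hneg,
      neg_one_mul, neg_neg]
  omega
end

/-! ### Exact counts by residue class. -/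

section
variable {F : Type*} [Field F] [Fintype F] [DecidableEq F]

/-- The correction at γ = -1 is 2(1 - χ(-2)): it is 4 if Q ≡ 7 mod 8 and 0 if Q ≡ 3 mod 8. -/
theorem nonsquareTripleCount_of_card_mod_four_eq_three (hF : Fintype.card F % 4 = 3) :
    8 * (nonsquareTripleCount F : ℤ) =
      Fintype.card F - if Fintype.card F % 8 = 7 then 7 else 3 := by
  have hchar : ringChar F ≠ 2 := fun h ↦ by
    have := FiniteField.even_card_of_char_two h
    omega
  have h2 : (2 : F) ≠ 0 := Ring.two_ne_zero hchar
  have hneg : quadraticChar F (-1) = -1 := by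
    rw [quadraticChar_neg_one_iff_not_isSquare, FiniteField.isSquare_neg_one_iff]
    omega
  rw [eight_mul_nonsquareTripleCount hchar, sum_quadraticChar_cube_sub_eq_zero hF, hneg]
  split_ifs with h
  · have hneg2 : quadraticChar F (-2) = -1 := by
      rw [quadraticChar_neg_one_iff_not_isSquare, FiniteField.isSquare_neg_two_iff]
      omega
    rw [hneg2]; ring
  · have hneg2 : quadraticChar F (-2) = 1 := by
      rw [quadraticChar_one_iff_isSquare (neg_ne_zero.mpr h2), FiniteField.isSquare_neg_two_iff]
      omega
    rw [hneg2]; ring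

theorem exists_nonsquareTripleCount_of_card_mod_four_eq_one (hF : Fintype.card F % 4 = 1) :
    ∃ a b : ℤ, 8 * (nonsquareTripleCount F : ℤ) = Fintype.card F - 3 - 2 * a ∧
      ∑ x : F, quadraticChar F (x * (x ^ 2 - 1)) = 2 * a ∧
      (Fintype.card F : ℤ) = a ^ 2 + b ^ 2 ∧ 2 ∣ b ∧ 4 ∣ a + 1 - b := by
  have hchar : ringChar F ≠ 2 := fun h ↦ by
    have := FiniteField.even_card_of_char_two h
    omega
  have hneg : quadraticChar F (-1) = 1 := by
    rw [quadraticChar_one_iff_isSquare (neg_ne_zero.mpr one_ne_zero),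
      FiniteField.isSquare_neg_one_iff]
    omega
  obtain ⟨a, b, hS, h⟩ := exists_sum_quadraticChar_cube_sub_eq_two_mul hF
  refine ⟨a, b, ?_, hS, h⟩
  rw [eight_mul_nonsquareTripleCount hchar, hneg, hS]; ring
end

theorem IsNormalizedCoordinate.unique {p r : ℕ} (hp : p.Prime) (hp2 : Odd p) (hr : r ≠ 0)
    {s u : ℤ} (hs : IsNormalizedCoordinate p (p ^ r) s) (hu : IsNormalizedCoordinate p (p ^ r) u) :
    s = u := by
  obtain ⟨hs4, hps, t, hst⟩ := hs
  obtain ⟨hu4, hpu, v, huv⟩ := hu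
  rw [Int.ModEq] at hs4 hu4
  push_cast at hst huv
  have h := sq_eq_sq_of_sum_two_squares_eq_prime_pow hp hp2 hr hst huv
    (Int.odd_iff.mpr (by omega)) (Int.odd_iff.mpr (by omega)) hps hpu
  rcases sq_eq_sq_iff_eq_or_eq_neg.mp h with h | h <;> omega

theorem IsNormalizedCoordinate.sq_lt {p r : ℕ} (hp : p.Prime) (hr : r ≠ 0) {s : ℤ}
    (hs : IsNormalizedCoordinate p (p ^ r) s) : s ^ 2 < (p ^ r : ℕ) := by
  obtain ⟨-, hps, t, hst⟩ := hs
  have ht : t ≠ 0 := by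
    rintro rfl
    have hdvd : (p : ℤ) ∣ s ^ 2 + 0 ^ 2 := by
      rw [← hst]; push_cast; exact dvd_pow_self _ hr
    rw [zero_pow two_ne_zero, add_zero] at hdvd
    exact hps ((Nat.prime_iff_prime_int.mp hp).dvd_of_dvd_pow hdvd)
  have := pow_pos (abs_pos.mpr ht) 2
  rw [sq_abs] at this
  linarith

/-- The count of nonsquare triples when the characteristic is `1` modulo `4`. -/
theorem exists_isNormalizedCoordinate_nonsquareTripleCount {F : Type*} [Field F] [Finite F]
    {p r : ℕ} (hp : p.Prime) (hp1 : p % 4 = 1) (hF : Nat.card F = p ^ r) :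
    ∃ s : ℤ, IsNormalizedCoordinate p (p ^ r) s ∧
      8 * (nonsquareTripleCount F : ℤ) =
        (p ^ r : ℕ) - 3 + if p ^ r % 8 = 1 then 2 * s else -(2 * s) := by
  classical
  have := Fintype.ofFinite F
  rw [Nat.card_eq_fintype_card] at hF
  have hmod : p ^ r % 4 = 1 := by simp [Nat.pow_mod, hp1]
  obtain ⟨a, b, hN, hS, hab, hb, h4⟩ :=
    exists_nonsquareTripleCount_of_card_mod_four_eq_one (F := F) (hF ▸ hmod)
  have hpa : ¬ (p : ℤ) ∣ a := fun h ↦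
    not_dvd_sum_quadraticChar_cube_sub hp hp1 hF (hS ▸ h.mul_left 2)
  rw [hF] at hN hab
  obtain ⟨c, rfl⟩ := hb
  -- As a² ≡ 1 mod 8 and b = 2c, Q ≡ 1 mod 8 exactly when c is even. Then a ≡ b - 1 mod 4 gives a ≡
  -- -1, so -a is normalized; for c odd, a itself is.
  have ha2 : 8 ∣ a ^ 2 - 1 := Int.eight_dvd_sq_sub_one_of_odd (Int.odd_iff.mpr (by omega))
  split_ifs with h8
  · refine ⟨-a, ⟨?_, by rwa [dvd_neg], 2 * c, by rw [neg_sq, hab]⟩, by rw [hN]; ring⟩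
    have hc : c ^ 2 % 2 = 0 := by
      rw [mul_pow] at hab
      omega
    have hc2 : c % 2 = 0 := Int.even_iff.mp (Int.even_pow.mp (Int.even_iff.mpr hc)).1
    rw [Int.ModEq]; omega
  · refine ⟨a, ⟨?_, hpa, 2 * c, hab⟩, by rw [hN]; ring⟩
    have hc : c ^ 2 % 2 = 1 := by
      rw [mul_pow] at hab
      omega
    have hc2 : c % 2 = 1 := Int.odd_iff.mp ((Int.odd_pow' two_ne_zero).mp (Int.odd_iff.mpr hc))
    rw [Int.ModEq]; omega

/-- The count of nonsquare triples for even-degree fields of characteristic `3` modulo `4`. -/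
theorem nonsquareTripleCount_of_char_mod_four_eq_three {F : Type*} [Field F] [Finite F]
    {p m : ℕ} (hp : p.Prime) (hp3 : p % 4 = 3) (hF : Nat.card F = p ^ (2 * m)) :
    8 * (nonsquareTripleCount F : ℤ) = (p ^ (2 * m) : ℕ) - 3 + 2 * (-1) ^ m * (p : ℤ) ^ m := by
  classical
  have := Fintype.ofFinite F
  rw [Nat.card_eq_fintype_card] at hF
  have hmod : p ^ (2 * m) % 4 = 1 := by
    rw [pow_mul, Nat.pow_mod, Nat.pow_mod p, hp3]
    norm_num
  obtain ⟨a, b, hN, -, hab, hb, h4⟩ :=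
    exists_nonsquareTripleCount_of_card_mod_four_eq_one (F := F) (hF ▸ hmod)
  rw [hF] at hN hab
  push_cast at hab
  obtain ⟨rfl, ha⟩ := sum_two_squares_eq_prime_pow_of_mod_four_eq_three hp hp3 m
    (Int.odd_iff.mpr (by omega)) hab.symm
  -- With b = 0 the congruence reads a ≡ -1 mod 4, which selects a = -(-1)^m p^m.
  have hpm : (p : ℤ) ^ m ≡ (-1) ^ m [ZMOD 4] :=
    Int.ModEq.pow m (by rw [Int.ModEq]; omega)
  rw [hN]
  rw [Int.ModEq] at hpm
  rcases Nat.even_or_odd m with hm | hm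
  · rw [hm.neg_one_pow] at hpm ⊢
    rcases ha with rfl | rfl
    · omega
    · ring
  · rw [hm.neg_one_pow] at hpm ⊢
    rcases ha with rfl | rfl
    · ring
    · omega

/-! ### Assembly of the theorem. -/

theorem theorem1p2 (p r Q : ℕ) (hp : p.Prime) (hodd : Odd p) (hQ : Q = p ^ r)
    {F : Type*} [Field F] [Finite F] (hF : Nat.card F = Q) :
    -- small fields
    (Q ≤ 9 → nonsquareTripleCount F = 0) ∧
    -- the lower bound, and when it is attained
    (9 < Q →
      ((Q : ℝ) - 2 * √(Q : ℝ) - 3) / 8 ≤ (nonsquareTripleCount F : ℝ) ∧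
      ((nonsquareTripleCount F : ℝ) = ((Q : ℝ) - 2 * √(Q : ℝ) - 3) / 8 ↔
        p ≡ 3 [MOD 4] ∧ ∃ s : ℕ, Odd s ∧ r = 2 * s)) ∧
    -- positivity
    (0 < nonsquareTripleCount F ↔ 9 < Q) ∧
    -- the exact value in each of the five residue cases
    (Q ≡ 7 [MOD 8] → (nonsquareTripleCount F : ℝ) = ((Q : ℝ) - 7) / 8) ∧
    (Q ≡ 3 [MOD 8] → (nonsquareTripleCount F : ℝ) = ((Q : ℝ) - 3) / 8) ∧
    (Q ≡ 5 [MOD 8] →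
      (∃! s : ℤ, IsNormalizedCoordinate p Q s) ∧
      ∀ s : ℤ, IsNormalizedCoordinate p Q s →
        (nonsquareTripleCount F : ℝ) = ((Q : ℝ) - 2 * (s : ℝ) - 3) / 8) ∧
    (Q ≡ 1 [MOD 8] → p ≡ 1 [MOD 4] →
      (∃! s : ℤ, IsNormalizedCoordinate p Q s) ∧
      ∀ s : ℤ, IsNormalizedCoordinate p Q s →
        (nonsquareTripleCount F : ℝ) = ((Q : ℝ) + 2 * (s : ℝ) - 3) / 8) ∧
    (Q ≡ 1 [MOD 8] → p ≡ 3 [MOD 4] →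
      ∃ m : ℕ, r = 2 * m ∧
        (nonsquareTripleCount F : ℝ) =
          ((Q : ℝ) + 2 * (-1) ^ m * √(Q : ℝ) - 3) / 8) := by
  have hr : r ≠ 0 := by
    rintro rfl
    have := Finite.one_lt_card (α := F)
    rw [hF, hQ, pow_zero] at this
    omega
  subst hQ
  have hp4 : p % 4 = 1 ∨ p % 4 = 3 := by
    have := Nat.odd_iff.mp hodd
    omega
  set N := nonsquareTripleCount F with hNdef
  have hsqrt : 9 < p ^ r → (3 : ℝ) < √((p ^ r : ℕ) : ℝ) := fun h ↦ by
    rw [Real.lt_sqrt (by norm_num)]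
    exact_mod_cast (by norm_num; exact h : 3 ^ 2 < p ^ r)
  have hsq := Real.sq_sqrt (Nat.cast_nonneg (α := ℝ) (p ^ r))
  have hpos : ((p ^ r ≤ 9 → N = 0) ∧ (9 < p ^ r → ((p ^ r : ℕ) - 2 * √((p ^ r : ℕ) : ℝ) - 3) / 8 ≤
      (N : ℝ))) → (0 < N ↔ 9 < p ^ r) := by
    rintro ⟨h1, h2⟩
    refine ⟨fun h ↦ not_le.mp fun h' ↦ h.ne' (h1 h'), fun h ↦ ?_⟩
    have := hsqrt h
    have := h2 h
    -- Q - 2√Q - 3 = (√Q - 3)(√Q + 1).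
    have : (0 : ℝ) < N := by nlinarith
    exact_mod_cast this
  simp only [Nat.ModEq]
  have combine : ∀ {A B C D : Prop}, (A ∧ B → D) → A ∧ B ∧ C → A ∧ B ∧ D ∧ C :=
    fun h ⟨a, b, c⟩ ↦ ⟨a, b, h ⟨a, b⟩, c⟩
  refine combine (fun h ↦ hpos ⟨h.1, fun h' ↦ (h.2 h').1⟩) ?_
  rcases hp4 with hp1 | hp3
  · have hmod : p ^ r % 4 = 1 := by simp [Nat.pow_mod, hp1]
    obtain ⟨s, hs, hN⟩ := exists_isNormalizedCoordinate_nonsquareTripleCount hp hp1 hF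
    rw [← hNdef] at hN
    have huniq : ∃! s : ℤ, IsNormalizedCoordinate p (p ^ r) s :=
      ⟨s, hs, fun u hu ↦ hu.unique hp hodd hr hs⟩
    have hlt := hs.sq_lt hp hr
    have hlt' : |(s : ℝ)| < √((p ^ r : ℕ) : ℝ) := Real.lt_sqrt_of_sq_lt (by
      rw [sq_abs]; exact_mod_cast hlt)
    obtain ⟨hs1, hs2⟩ := abs_lt.mp hlt'
    have hNR : 8 * (N : ℝ) = (p ^ r : ℕ) - 3 + if p ^ r % 8 = 1 then 2 * (s : ℝ) else -(2 * s) := by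
      exact_mod_cast hN
    have hstrict : ((p ^ r : ℕ) - 2 * √((p ^ r : ℕ) : ℝ) - 3) / 8 < (N : ℝ) := by
      split_ifs at hNR <;> linarith
    refine ⟨fun h9 ↦ ?_, fun _ ↦ ⟨hstrict.le, fun h ↦ absurd h hstrict.ne', fun h ↦ by omega⟩,
      fun h ↦ by omega, fun h ↦ by omega, fun h ↦ ⟨huniq, fun u hu ↦ ?_⟩,
      fun h _ ↦ ⟨huniq, fun u hu ↦ ?_⟩, fun _ h ↦ by omega⟩
    · have hp5 : 5 ≤ p := by
        have := hp.two_le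
        omega
      have hle : p ≤ p ^ r := Nat.le_self_pow hr p
      have hne9 : p ^ r ≠ 9 := fun h ↦ by
        have h3 : p ∣ 3 ^ 2 := (h ▸ dvd_pow_self p hr : p ∣ 9)
        have := (Nat.prime_dvd_prime_iff_eq hp Nat.prime_three).mp (hp.dvd_of_dvd_pow h3)
        omega
      have h5 : p ^ r = 5 := by omega
      rw [h5] at hN hlt
      push_cast at hlt
      -- Here 8N = 2 - 2s < 8, so N = 0.
      have : -3 < s := by nlinarith
      norm_num at hN
      omega
    · rw [hu.unique hp hodd hr hs]
      rw [if_neg (by omega)] at hNR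
      linarith
    · rw [hu.unique hp hodd hr hs]
      rw [if_pos h] at hNR
      linarith
  · rcases Nat.even_or_odd' r with ⟨m, hm | hm⟩
    · have hN : 8 * (N : ℤ) = _ :=
        nonsquareTripleCount_of_char_mod_four_eq_three hp hp3 (hm ▸ hF)
      rw [← hm] at hN
      have hQ : p ^ r = (p ^ m) ^ 2 := by rw [hm, mul_comm, pow_mul]
      have hodd' := Nat.odd_iff.mp (hodd.pow (n := m))
      have hmod : p ^ r % 8 = 1 := by
        rw [hQ, Nat.pow_mod]
        have : p ^ m % 8 = 1 ∨ p ^ m % 8 = 3 ∨ p ^ m % 8 = 5 ∨ p ^ m % 8 = 7 := by omega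
        rcases this with h | h | h | h <;> rw [h]
      have hroot : √((p ^ r : ℕ) : ℝ) = (p : ℝ) ^ m := by
        rw [hQ]; push_cast; exact Real.sqrt_sq (by positivity)
      have hNR : 8 * (N : ℝ) = (p ^ r : ℕ) - 3 + 2 * (-1) ^ m * √((p ^ r : ℕ) : ℝ) := by
        rw [hroot]; exact_mod_cast hN
      refine ⟨fun h9 ↦ ?_, fun h9 ↦ ?_, fun h ↦ by omega, fun h ↦ by omega, fun h ↦ by omega,
        fun _ h ↦ by omega, fun _ _ ↦ ⟨m, hm, by linarith⟩⟩
      · have hm0 : m ≠ 0 := by omega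
        have hp3' : 3 ≤ p := by omega
        have hle : p ≤ p ^ m := Nat.le_self_pow hm0 p
        have h3 : p ^ m = 3 := by nlinarith
        have h3' : (p : ℤ) ^ m = 3 := by exact_mod_cast h3
        rw [hQ, h3, h3'] at hN
        -- For Q = 9, 8N = 6 ± 6; the value 12 is not divisible by 8, so N = 0.
        rcases neg_one_pow_eq_or ℤ m with h | h <;> rw [h] at hN <;> norm_num at hN <;> omega
      · have h3 := hsqrt h9
        rcases Nat.even_or_odd m with h | h
        · rw [h.neg_one_pow] at hNR
          refine ⟨by linarith, fun h' ↦ by linarith, ?_⟩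
          rintro ⟨-, s, hs, hrs⟩
          obtain rfl : m = s := by omega
          exact absurd h (Nat.not_even_iff_odd.mpr hs)
        · rw [h.neg_one_pow] at hNR
          exact ⟨by linarith, fun _ ↦ ⟨hp3, m, h, hm⟩, fun _ ↦ by linarith⟩
    · have hmod : p ^ r % 4 = 3 := by
        rw [hm, pow_succ, pow_mul, Nat.mul_mod, Nat.pow_mod, Nat.pow_mod p, hp3]
        norm_num
      classical
      have := Fintype.ofFinite F
      have hcard : Fintype.card F = p ^ r := by rw [← Nat.card_eq_fintype_card, hF]
      have hN := nonsquareTripleCount_of_card_mod_four_eq_three (F := F) (hcard ▸ hmod)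
      rw [hcard, ← hNdef] at hN
      have hNR : 8 * (N : ℝ) = (p ^ r : ℕ) - if p ^ r % 8 = 7 then (7 : ℝ) else 3 := by
        exact_mod_cast hN
      refine ⟨fun h9 ↦ ?_, fun h9 ↦ ?_, fun h ↦ ?_, fun h ↦ ?_, fun h ↦ by omega,
        fun h ↦ by omega, fun h ↦ by omega⟩
      · split_ifs at hN <;> omega
      · have h3 := hsqrt h9
        have hstrict : ((p ^ r : ℕ) - 2 * √((p ^ r : ℕ) : ℝ) - 3) / 8 < (N : ℝ) := by
          -- The case Q - 7 needs 7 < 2√Q + 3, which holds since √Q > 3.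
          split_ifs at hNR <;> linarith
        refine ⟨hstrict.le, fun h ↦ absurd h hstrict.ne', ?_⟩
        rintro ⟨-, s, -, hs⟩
        omega
      · rw [if_pos h] at hNR
        linarith
      · rw [if_neg (by omega)] at hNR
        linarith
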